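/- All Lie algebras are over $\mathbb{R}$ or $\mathbb{C}$. For a complex Lie algebra $\mathfrak{h}$ let $\mathfrak{h}_{\mathbb{R}}$ be the underlying real Lie algebra, obtained by restricting scalars from $\mathbb{C}$ to $\mathbb{R}$. A real Lie algebra $\mathfrak{g}$ has exactly $n$ different bi-invariant complex structures if there are, up to isomorphism of complex Lie algebras, exactly $n$ complex Lie algebras $\mathfrak{h}$ with $\mathfrak{h}_{\mathbb{R}}\cong\mathfrak{g}$ (as real Lie algebras). A Lie algebra is called $2$-step nilpotent if its nilpotency class is exactly $2$. For $\lambda\in\mathbb{C}$ let $\mathfrak{g}_\lambda$ be the complex Lie algebra of dimension $10$ with basis $X_1,\dots,X_8,Z_1,Z_2$ and brackets $$[X_1,X_5]=[X_2,X_6]=[X_3,X_7]=[X_4,X_8]=Z_1,$$ $$[X_2,X_5]=[X_3,X_6]=[X_4,X_7]=Z_2,\quad [X_1,X_8]=-Z_2,\quad [X_2,X_7]=-\lambda Z_2,$$ all other brackets of basis vectors being zero, up to antisymmetry. Then the following hold. 1. For every integer $n\ge 1$ there exists a finite-dimensional real $2$-step nilpotent Lie algebra which has exactly $n$ different bi-invariant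 complex structures. 2. There exists $\lambda\in\mathbb{C}$ such that $\mathfrak{g}_\lambda\not\cong\mathfrak{g}_{\overline{\lambda}}$ as complex Lie algebras. 3. For every $\lambda\in\mathbb{C}$ with $\mathfrak{g}_\lambda\not\cong\mathfrak{g}_{\overline{\lambda}}$ and every integer $k\ge 0$, the real Lie algebra $\big(\mathfrak{g}_\lambda^{\oplus k}\big)_{\mathbb{R}}$ underlying the direct sum of $k$ copies of $\mathfrak{g}_\lambda$ has exactly $k+1$ different bi-invariant complex structures, and it is $2$-step nilpotent if $k\ge 1$. (So for $n\ge 2$ statement 1 is realised with $n-1$ copies.) 4. In particular, there exist two non-isomorphic finite-dimensional complex $2$-step nilpotent Lie algebras $\mathfrak{h}_1,\mathfrak{h}_2$ with $(\mathfrak{h}_1)_{\mathbb{R}}\cong(\mathfrak{h}_2)_{\mathbb{R}}$ (a question of Di Scala, Lauret and Vezzoni). -/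

import Mathlib

open scoped DirectSum

/-- A complex Lie algebra (bundled, so that families of them can be listed). -/
structure ComplexLieAlgebra where
  /-- The underlying type. -/
  carrier : Type
  [lieRing : LieRing carrier]
  [lieAlgebra : LieAlgebra ℂ carrier]

attribute [instance] ComplexLieAlgebra.lieRing ComplexLieAlgebra.lieAlgebra

/-- The underlying real Lie algebra `h_ℝ` of a complex Lie algebra `h`: the same Lie ring,
with scalar multiplication restricted from `ℂ` to `ℝ`. -/
abbrev Realification (h : Type) [LieRing h] [LieAlgebra ℂ h] : Type := RestrictScalars ℝ ℂ h

/-- The complex Lie algebra `h` gives a bi-invariant complex structure on the real Lie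
algebra `g`: the underlying real Lie algebra of `h` is isomorphic to `g`. -/
def ComplexLieAlgebra.IsComplexStructureOn (h : ComplexLieAlgebra)
    (g : Type) [LieRing g] [LieAlgebra ℝ g] : Prop :=
  Nonempty (Realification h.carrier ≃ₗ⁅ℝ⁆ g)

/-- The real Lie algebra `g` has exactly `n` different bi-invariant complex structures: there is
a list of `n` pairwise non-isomorphic complex Lie algebras whose underlying real Lie algebra is
isomorphic to `g`, and every complex Lie algebra whose underlying real Lie algebra is isomorphic
to `g` is isomorphic, over `ℂ`, to one in the list. -/
def HasExactlyComplexStructures (g : Type) [LieRing g] [LieAlgebra ℝ g] (n : ℕ) : Prop :=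
  ∃ h : Fin n → ComplexLieAlgebra,
    (∀ i, (h i).IsComplexStructureOn g) ∧
    (∀ i j, i ≠ j → ¬ Nonempty ((h i).carrier ≃ₗ⁅ℂ⁆ (h j).carrier)) ∧
    ∀ h' : ComplexLieAlgebra, h'.IsComplexStructureOn g →
      ∃ i, Nonempty (h'.carrier ≃ₗ⁅ℂ⁆ (h i).carrier)

/-- A Lie algebra is `2`-step nilpotent if its nilpotency class is exactly `2`, i.e.
`[g, [g, g]] = 0` and `[g, g] ≠ 0`. -/
def IsTwoStepNilpotent (g : Type) [LieRing g] : Prop :=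
  LieModule.nilpotencyLength g g = 2

/-- The underlying vector space of the `10`-dimensional complex Lie algebra `g_l`, with basis
`X₁, …, X₈` (the standard basis of the first factor) and `Z₁, Z₂` (that of the second). -/
def GLam (_l : ℂ) : Type := (Fin 8 → ℂ) × (Fin 2 → ℂ)

namespace GLam

variable (l : ℂ)

instance : AddCommGroup (GLam l) := inferInstanceAs (AddCommGroup ((Fin 8 → ℂ) × (Fin 2 → ℂ)))

instance : Module ℂ (GLam l) := inferInstanceAs (Module ℂ ((Fin 8 → ℂ) × (Fin 2 → ℂ)))

/-- The basis vector `X_{i+1}`. -/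
def X (i : Fin 8) : GLam l := (Pi.single i 1, 0)

/-- The basis vector `Z_{i+1}`. -/
def Z (i : Fin 2) : GLam l := (0, Pi.single i 1)

/-- The coefficient of `Z₁` in the bracket. -/
def coeff₁ (x y : Fin 8 → ℂ) : ℂ :=
  (x 0 * y 4 - x 4 * y 0) + (x 1 * y 5 - x 5 * y 1) + (x 2 * y 6 - x 6 * y 2)
    + (x 3 * y 7 - x 7 * y 3)

/-- The coefficient of `Z₂` in the bracket. -/
def coeff₂ (x y : Fin 8 → ℂ) : ℂ :=
  (x 1 * y 4 - x 4 * y 1) + (x 2 * y 5 - x 5 * y 2) + (x 3 * y 6 - x 6 * y 3)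
    - (x 0 * y 7 - x 7 * y 0) - l * (x 1 * y 6 - x 6 * y 1)

instance : Bracket (GLam l) (GLam l) where
  bracket u v := (0, ![coeff₁ u.1 v.1, coeff₂ l u.1 v.1])

theorem bracket_def (u v : GLam l) :
    ⁅u, v⁆ = ((0, ![coeff₁ u.1 v.1, coeff₂ l u.1 v.1]) : (Fin 8 → ℂ) × (Fin 2 → ℂ)) := rfl

@[simp] theorem add_fst (u v : GLam l) (i : Fin 8) : (u + v).1 i = u.1 i + v.1 i := rfl

@[simp] theorem add_snd (u v : GLam l) (i : Fin 2) : (u + v).2 i = u.2 i + v.2 i := rfl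

@[simp] theorem smul_fst (c : ℂ) (u : GLam l) (i : Fin 8) : (c • u).1 i = c * u.1 i := rfl

@[simp] theorem smul_snd (c : ℂ) (u : GLam l) (i : Fin 2) : (c • u).2 i = c * u.2 i := rfl

@[simp] theorem neg_fst (u : GLam l) (i : Fin 8) : (-u).1 i = -u.1 i := rfl

@[simp] theorem neg_snd (u : GLam l) (i : Fin 2) : (-u).2 i = -u.2 i := rfl

@[simp] theorem zero_fst (i : Fin 8) : (0 : GLam l).1 i = 0 := rfl

@[simp] theorem zero_snd (i : Fin 2) : (0 : GLam l).2 i = 0 := rfl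

@[simp] theorem bracket_fst (u v : GLam l) (i : Fin 8) : (⁅u, v⁆ : GLam l).1 i = 0 := rfl

@[simp] theorem bracket_snd_zero (u v : GLam l) :
    (⁅u, v⁆ : GLam l).2 0 = coeff₁ u.1 v.1 := rfl

@[simp] theorem bracket_snd_one (u v : GLam l) :
    (⁅u, v⁆ : GLam l).2 1 = coeff₂ l u.1 v.1 := rfl

variable {l} in
theorem ext_coord {u v : GLam l} (h : ∀ i, u.1 i = v.1 i) (h0 : u.2 0 = v.2 0)
    (h1 : u.2 1 = v.2 1) : u = v :=
  Prod.ext (funext h) (funext fun i => by fin_cases i <;> assumption)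

instance : LieRing (GLam l) where
  add_lie u v w := by
    refine ext_coord (fun i => ?_) ?_ ?_ <;> simp [coeff₁, coeff₂] <;> ring
  lie_add u v w := by
    refine ext_coord (fun i => ?_) ?_ ?_ <;> simp [coeff₁, coeff₂] <;> ring
  lie_self u := by
    refine ext_coord (fun i => ?_) ?_ ?_ <;> simp [coeff₁, coeff₂] <;> ring
  leibniz_lie u v w := by
    refine ext_coord (fun i => ?_) ?_ ?_ <;> simp [coeff₁, coeff₂]

instance : LieAlgebra ℂ (GLam l) where
  lie_smul c u v := by
    refine ext_coord (fun i => ?_) ?_ ?_ <;> simp [coeff₁, coeff₂] <;> ring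

@[simp] theorem X_fst (i : Fin 8) : (X l i).1 = Pi.single i 1 := rfl

@[simp] theorem X_snd (i : Fin 8) : (X l i).2 = 0 := rfl

@[simp] theorem Z_fst (i : Fin 2) : (Z l i).1 = 0 := rfl

@[simp] theorem Z_snd (i : Fin 2) : (Z l i).2 = Pi.single i 1 := rfl

/-- The defining brackets of basis vectors (up to antisymmetry, all others vanish). -/
theorem bracket_basis :
    ⁅X l 0, X l 4⁆ = Z l 0 ∧ ⁅X l 1, X l 5⁆ = Z l 0 ∧ ⁅X l 2, X l 6⁆ = Z l 0 ∧
    ⁅X l 3, X l 7⁆ = Z l 0 ∧ ⁅X l 1, X l 4⁆ = Z l 1 ∧ ⁅X l 2, X l 5⁆ = Z l 1 ∧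
    ⁅X l 3, X l 6⁆ = Z l 1 ∧ ⁅X l 0, X l 7⁆ = -Z l 1 ∧ ⁅X l 1, X l 6⁆ = -l • Z l 1 := by
  refine ⟨?_, ?_, ?_, ?_, ?_, ?_, ?_, ?_, ?_⟩ <;> refine ext_coord (fun i => ?_) ?_ ?_ <;>
    simp [coeff₁, coeff₂]

end GLam

/-! The main tool is the centroid: maps `T` with `T ⁅x, y⁆ = ⁅T x, y⁆`. On a sum of algebras `g_l`
such a map is a scalar on each block, both modulo the centre and on the centre
(`exists_scalars_of_centroid`).

For a complex structure on the realification of `g_l^{⊕ k}`, multiplication by `i` is a centroid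
map, so its scalars square to `-1` and are `i` or `-i`. After a central correction
(`exists_blockwise_form`), conjugating the coordinates of the `-i` blocks gives `a` copies of `g_l`
and `k - a` copies of `g_{l̄}` (`exists_equiv_mixedSum`). Block projections also lie in the
centroid, so the summands are unique (`exists_injective_of_equiv`). If `g_l ≇ g_{l̄}`, the values `a
= 0, …, k` therefore give `k + 1` distinct structures.

To separate `g_l` from `g_{l̄}`, compose the bracket with functionals on the centre. The resulting
pencil of alternating forms degenerates at the zeros of `a⁴ + l a² b² + b⁴`, and an isomorphism
induces a linear substitution between these quartics. The classical invariants of binary quartics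
then tell `1 + i` from `1 - i`. -/

/-- A Lie ring is `2`-step nilpotent as soon as all double brackets vanish and some bracket does
not. -/
theorem isTwoStepNilpotent_of_lie {g : Type} [LieRing g] (h : ∀ x y z : g, ⁅x, ⁅y, z⁆⁆ = 0)
    {x y : g} (hxy : ⁅x, y⁆ ≠ 0) : IsTwoStepNilpotent g := by
  unfold IsTwoStepNilpotent
  rw [LieModule.nilpotencyLength_eq_succ_iff ℤ g g 1]
  have key : ∀ m ∈ LieModule.lowerCentralSeries ℤ g g 1, ∀ x : g, ⁅x, m⁆ = 0 := by
    intro m hm x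
    rw [LieModule.lowerCentralSeries_succ, LieModule.lowerCentralSeries_zero] at hm
    rw [← LieSubmodule.mem_toSubmodule, LieSubmodule.lieIdeal_oper_eq_linear_span'] at hm
    induction hm using Submodule.span_induction with
    | mem z hz => obtain ⟨a, -, b, -, rfl⟩ := hz; exact h _ _ _
    | zero => simp
    | add a b _ _ ha hb => simp [ha, hb]
    | smul c a _ ha => rw [lie_zsmul, ha, smul_zero]
  refine ⟨?_, fun h0 => hxy ?_⟩
  · rw [LieModule.lowerCentralSeries_succ, LieSubmodule.lie_eq_bot_iff]
    exact fun x _ m hm => key m hm x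
  · have : ⁅x, y⁆ ∈ LieModule.lowerCentralSeries ℤ g g 1 := by
      rw [LieModule.lowerCentralSeries_succ]
      exact LieSubmodule.lie_mem_lie (LieSubmodule.mem_top _) (LieSubmodule.mem_top _)
    rw [h0] at this
    simpa using this

/-- Real Lie algebra isomorphisms between realifications, in terms of additive maps. -/
theorem nonempty_realification_equiv_iff {h h' : Type} [LieRing h] [LieAlgebra ℂ h] [LieRing h']
    [LieAlgebra ℂ h'] : Nonempty (Realification h ≃ₗ⁅ℝ⁆ Realification h') ↔
      ∃ g : h ≃+ h', (∀ x y, g ⁅x, y⁆ = ⁅g x, g y⁆) ∧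
        ∀ (r : ℝ) (x : h), g ((r : ℂ) • x) = (r : ℂ) • g x := by
  constructor
  · rintro ⟨e⟩
    exact ⟨e.toLinearEquiv.toAddEquiv, fun x y => e.map_lie x y, fun r x => e.map_smul r x⟩
  · rintro ⟨g, h1, h2⟩
    let f : Realification h →ₗ⁅ℝ⁆ Realification h' :=
      { toFun := g, map_add' := g.map_add, map_smul' := h2, map_lie' := h1 _ _ }
    exact ⟨LieEquiv.ofBijective f g.bijective⟩

/-! ### Centre and centroid of `g_l`. -/

namespace GLam

variable {l : ℂ}

theorem lie_congr {u u' v v' : GLam l} (hu : u.1 = u'.1) (hv : v.1 = v'.1) :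
    ⁅u, v⁆ = ⁅u', v'⁆ := by
  rw [bracket_def, hu, hv]; rfl

theorem lie_eq_zero_of_fst {u : GLam l} (hu : u.1 = 0) (v : GLam l) : ⁅u, v⁆ = 0 := by
  rw [lie_congr (u' := 0) hu rfl, zero_lie]

theorem lie_lie_eq_zero (u v w : GLam l) : ⁅u, ⁅v, w⁆⁆ = 0 := by
  rw [← lie_skew, lie_eq_zero_of_fst rfl, neg_zero]

/-- The first components are determined by the brackets. -/
theorem fst_eq_of_lie {u u' : GLam l} (h : ∀ v : GLam l, ⁅u, v⁆ = ⁅u', v⁆) : u.1 = u'.1 := by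
  -- The form `coeff₁` alone is symplectic: pairing with the `X l i` reads off all eight coordinates
  -- up to sign.
  have key := fun i => congrArg (fun w : GLam l => w.2 0) (h (X l i))
  funext i
  have h0 := key 0
  have h1 := key 1
  have h2 := key 2
  have h3 := key 3
  have h4 := key 4
  have h5 := key 5
  have h6 := key 6
  have h7 := key 7
  simp [coeff₁] at h0 h1 h2 h3 h4 h5 h6 h7
  fin_cases i <;> assumption

theorem fst_eq_zero_of_lie {u : GLam l} (h : ∀ v : GLam l, ⁅u, v⁆ = 0) : u.1 = 0 :=
  fst_eq_of_lie (u' := 0) fun v => by rw [h, zero_lie]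

/-- Every central element is a bracket. -/
theorem exists_lie_eq {u : GLam l} (hu : u.1 = 0) : ∃ v w : GLam l, ⁅v, w⁆ = u := by
  refine ⟨X l 1, u.2 0 • X l 5 + u.2 1 • X l 4, ext_coord (fun i => ?_) ?_ ?_⟩
  · simp [hu]
  · simp [coeff₁]
  · simp [coeff₂]

/-- Modulo the centre, and on the centre, the centroid of `g_l` consists of scalars. -/
theorem exists_scalar_of_centroid (D : GLam l → GLam l) (hD : ∀ u v : GLam l, D ⁅u, v⁆ = ⁅D u, v⁆) :
    ∃ c : ℂ, (∀ u, (D u).1 = c • u.1) ∧ ∀ u, u.1 = 0 → D u = c • u := by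
  have hD' : ∀ u v : GLam l, ⁅D u, v⁆ = ⁅u, D v⁆ := by
    intro u v
    have h := hD v (-u)
    rw [lie_neg, lie_skew, lie_neg, lie_skew] at h
    rw [← hD, h]
  have D0 : D 0 = 0 := by simpa using hD 0 0
  have hz : ∀ u v : GLam l, ⁅u, v⁆ = 0 → ⁅D u, v⁆ = 0 := fun u v h => by rw [← hD, h, D0]
  obtain ⟨b1, b2, b3, b4, b5, b6, b7, b8, b9⟩ := bracket_basis l
  have e1 : ⁅D (X l 1), X l 5⁆ = ⁅D (X l 0), X l 4⁆ := by rw [← hD, ← hD, b1, b2]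
  have e2 : ⁅D (X l 2), X l 6⁆ = ⁅D (X l 0), X l 4⁆ := by rw [← hD, ← hD, b1, b3]
  have e3 : ⁅D (X l 3), X l 7⁆ = ⁅D (X l 0), X l 4⁆ := by rw [← hD, ← hD, b1, b4]
  -- `X₁, …, X₄` commute with one another, and so do `X₅, …, X₈`; the `Z₁`-coefficient then shows
  -- that `D` sends basis vectors of each half into that half, modulo the centre.
  have z1 : ∀ i j : Fin 8, i < 4 → j < 4 → (D (X l i)).1 (j + 4) = 0 := by
    intro i j hi hj
    have := congrArg (fun w : GLam l => w.2 0) (hz (X l i) (X l j) (by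
      refine ext_coord (fun i => rfl) ?_ ?_ <;>
      fin_cases i <;> fin_cases j <;> simp [coeff₁, coeff₂] at hi hj ⊢))
    fin_cases j <;> simp [coeff₁] at hj this ⊢ <;> exact this
  have z2 : ∀ i j : Fin 8, 4 ≤ i → j < 4 → (D (X l i)).1 j = 0 := by
    intro i j hi hj
    have := congrArg (fun w : GLam l => w.2 0) (hz (X l i) (X l (j + 4)) (by
      refine ext_coord (fun i => rfl) ?_ ?_ <;>
      fin_cases i <;> fin_cases j <;> simp [coeff₁, coeff₂] at hi hj ⊢))
    fin_cases j <;> simp [coeff₁] at hj this ⊢ <;> exact this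
  have hz1 : ∀ i j : Fin 8, ⁅X l i, X l j⁆ = 0 → coeff₁ (D (X l i)).1 (X l j).1 = 0 :=
    fun i j h => congrArg (fun w : GLam l => w.2 0) (hz _ _ h)
  have hz2 : ∀ i j : Fin 8, ⁅X l i, X l j⁆ = 0 → coeff₂ l (D (X l i)).1 (X l j).1 = 0 :=
    fun i j h => congrArg (fun w : GLam l => w.2 1) (hz _ _ h)
  -- These vanishing brackets, with the `Z₂` parts of `e1` and `e2`, kill the off-diagonal
  -- coefficients on the first half; the `Z₁` parts of `e1`, `e2`, `e3` equate the diagonal ones.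
  have z05 : ⁅X l 0, X l 5⁆ = 0 := by
    refine ext_coord (fun i => rfl) ?_ ?_ <;> simp [coeff₁, coeff₂]
  have z06 : ⁅X l 0, X l 6⁆ = 0 := by
    refine ext_coord (fun i => rfl) ?_ ?_ <;> simp [coeff₁, coeff₂]
  have z17 : ⁅X l 1, X l 7⁆ = 0 := by
    refine ext_coord (fun i => rfl) ?_ ?_ <;> simp [coeff₁, coeff₂]
  have z24 : ⁅X l 2, X l 4⁆ = 0 := by
    refine ext_coord (fun i => rfl) ?_ ?_ <;> simp [coeff₁, coeff₂]
  have z34 : ⁅X l 3, X l 4⁆ = 0 := by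
    refine ext_coord (fun i => rfl) ?_ ?_ <;> simp [coeff₁, coeff₂]
  have z35 : ⁅X l 3, X l 5⁆ = 0 := by
    refine ext_coord (fun i => rfl) ?_ ?_ <;> simp [coeff₁, coeff₂]
  have p05 := hz1 _ _ z05
  have p05' := hz2 _ _ z05
  have p06 := hz2 _ _ z06
  have p17 := hz1 _ _ z17
  have p17' := hz2 _ _ z17
  have p24 := hz1 _ _ z24
  have p24' := hz2 _ _ z24
  have p34 := hz1 _ _ z34
  have p34' := hz2 _ _ z34
  have p35' := hz2 _ _ z35
  have q1 := congrArg (fun w : GLam l => w.2 0) e1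
  have q1' := congrArg (fun w : GLam l => w.2 1) e1
  have q2 := congrArg (fun w : GLam l => w.2 0) e2
  have q2' := congrArg (fun w : GLam l => w.2 1) e2
  have q3 := congrArg (fun w : GLam l => w.2 0) e3
  simp [coeff₁, coeff₂] at p05 p05' p06 p17 p17' p24 p24' p34 p34' p35' q1 q1' q2 q2' q3
  rw [p05, mul_zero, sub_zero] at p06
  rw [p05] at q1'
  rw [p24', p05, mul_zero, sub_zero] at q2'
  set c := (D (X l 0)).1 0 with hc
  have w : ∀ i : Fin 8, i < 4 → (D (X l i)).1 = (c • X l i).1 := by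
    intro i hi
    have r4 := z1 i 0 hi (by decide)
    have r5 := z1 i 1 hi (by decide)
    have r6 := z1 i 2 hi (by decide)
    have r7 := z1 i 3 hi (by decide)
    funext j
    fin_cases i <;> simp at hi <;> fin_cases j <;> simp <;> assumption
  -- `D` is not assumed additive, so `D u` is recovered from `⁅D u, X l i⁆ = ⁅u, D (X l i)⁆` by
  -- nondegeneracy, one half of the coordinates at a time.
  have half : ∀ u : GLam l, ∀ j : Fin 8, 4 ≤ j → (D u).1 j = c * u.1 j := by
    intro u j hj
    have := fun (i : Fin 8) (hi : i < 4) => congrArg (fun w : GLam l => w.2 0)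
      ((hD' u (X l i)).trans (lie_congr rfl (w i hi)))
    have t0 := this 0 (by decide)
    have t1 := this 1 (by decide)
    have t2 := this 2 (by decide)
    have t3 := this 3 (by decide)
    simp [coeff₁] at t0 t1 t2 t3
    fin_cases j <;> simp at hj ⊢ <;> grind
  have w' : ∀ i : Fin 8, (D (X l i)).1 = (c • X l i).1 := by
    intro i
    by_cases hi : i < 4
    · exact w i hi
    · funext j
      by_cases hj : j < 4
      · rw [z2 i j (not_lt.mp hi) hj, smul_fst, X_fst, Pi.single_eq_of_ne (by grind), mul_zero]
      · exact half _ j (not_lt.mp hj)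
  have hu : ∀ u, (D u).1 = (c • u).1 := by
    intro u
    have := fun i => congrArg (fun w : GLam l => w.2 0)
      ((hD' u (X l i)).trans (lie_congr rfl (w' i)))
    have t4 := this 4
    have t5 := this 5
    have t6 := this 6
    have t7 := this 7
    simp [coeff₁] at t4 t5 t6 t7
    funext j
    by_cases hj : j < 4
    · fin_cases j <;> simp at hj ⊢ <;> grind
    · exact half _ j (not_lt.mp hj)
  refine ⟨c, hu, fun u h => ?_⟩
  obtain ⟨a, b, rfl⟩ := exists_lie_eq h
  rw [hD, lie_congr (hu a) rfl, smul_lie]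

/-! ### Semilinear coordinate maps, dimension and nilpotency of `g_l`. -/

/-- A field automorphism acts on coordinates. -/
def conjMap (τ : ℂ ≃+* ℂ) (l : ℂ) : GLam l ≃+ GLam (τ l) where
  toFun u := (fun i => τ (u.1 i), fun i => τ (u.2 i))
  invFun u := (fun i => τ.symm (u.1 i), fun i => τ.symm (u.2 i))
  left_inv _ := Prod.ext (funext fun _ => τ.symm_apply_apply _)
    (funext fun _ => τ.symm_apply_apply _)
  right_inv _ := Prod.ext (funext fun _ => τ.apply_symm_apply _)
    (funext fun _ => τ.apply_symm_apply _)
  map_add' _ _ := Prod.ext (funext fun _ => map_add τ _ _) (funext fun _ => map_add τ _ _)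

@[simp] theorem conjMap_fst (τ : ℂ ≃+* ℂ) (u : GLam l) (i : Fin 8) :
    (conjMap τ l u).1 i = τ (u.1 i) := rfl

@[simp] theorem conjMap_snd (τ : ℂ ≃+* ℂ) (u : GLam l) (i : Fin 2) :
    (conjMap τ l u).2 i = τ (u.2 i) := rfl

theorem conjMap_smul (τ : ℂ ≃+* ℂ) (c : ℂ) (u : GLam l) :
    conjMap τ l (c • u) = τ c • conjMap τ l u := by
  refine ext_coord (fun i => ?_) ?_ ?_ <;> simp

theorem conjMap_lie (τ : ℂ ≃+* ℂ) (u v : GLam l) :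
    conjMap τ l ⁅u, v⁆ = ⁅conjMap τ l u, conjMap τ l v⁆ := by
  refine ext_coord (fun i => ?_) ?_ ?_ <;> simp [coeff₁, coeff₂]

/-- The coordinate isomorphism. -/
def coordEquiv (l : ℂ) : GLam l ≃ₗ[ℂ] (Fin 8 → ℂ) × (Fin 2 → ℂ) := LinearEquiv.refl ℂ _

instance : FiniteDimensional ℂ (GLam l) := (coordEquiv l).symm.finiteDimensional

theorem finrank_eq (l : ℂ) : Module.finrank ℂ (GLam l) = 10 := by
  rw [(coordEquiv l).finrank_eq]; simp

theorem bijective_of_injective {l m : ℂ} (f : GLam l →ₗ⁅ℂ⁆ GLam m) (hf : Function.Injective f) :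
    Function.Bijective f :=
  ⟨hf, (LinearMap.injective_iff_surjective_of_finrank_eq_finrank (f := (f : GLam l →ₗ[ℂ] GLam m))
    (by rw [finrank_eq, finrank_eq])).mp hf⟩

theorem isTwoStepNilpotent (l : ℂ) : IsTwoStepNilpotent (GLam l) :=
  isTwoStepNilpotent_of_lie lie_lie_eq_zero (x := X l 0) (y := X l 4) (by
    rw [(bracket_basis l).1]
    intro h
    simpa using congrArg (fun w : GLam l => w.2 0) h)

/-! ### The quartic of the pencil and its invariants. -/

/-- The pencil of alternating forms given by the bracket. -/
def pencil (l a b : ℂ) (x y : Fin 8 → ℂ) : ℂ := a * coeff₁ x y + b * coeff₂ l x y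

/-- A degenerate member of the pencil is a zero of the quartic `a⁴ + l a² b² + b⁴`. -/
theorem quartic_eq_zero_of_pencil {a b : ℂ} {x : Fin 8 → ℂ} (hx : x ≠ 0)
    (h : ∀ y, pencil l a b x y = 0) : a ^ 4 + l * a ^ 2 * b ^ 2 + b ^ 4 = 0 := by
  have h0 := h (Pi.single 0 1)
  have h1 := h (Pi.single 1 1)
  have h2 := h (Pi.single 2 1)
  have h3 := h (Pi.single 3 1)
  have h4 := h (Pi.single 4 1)
  have h5 := h (Pi.single 5 1)
  have h6 := h (Pi.single 6 1)
  have h7 := h (Pi.single 7 1)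
  simp [pencil, coeff₁, coeff₂] at h0 h1 h2 h3 h4 h5 h6 h7
  -- The eight equations split into two `4 × 4` systems whose determinants are the quartic up to
  -- sign, so Cramer's rule gives quartic times `x i` equal to `0`.
  by_contra hq
  apply hx
  funext i
  apply (mul_eq_zero.mp _).resolve_left hq
  fin_cases i <;> simp <;> grind

/-- For `b = 1`, a zero of the quartic gives a degenerate member of the pencil. -/
theorem exists_pencil_of_quartic {a : ℂ} (h : a ^ 4 + l * a ^ 2 + 1 = 0) :
    ∃ x : Fin 8 → ℂ, x ≠ 0 ∧ ∀ y, pencil l a 1 x y = 0 := by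
  -- With first coordinate `1`, three of the equations fix the next three coordinates; the fourth is
  -- the quartic.
  refine ⟨![1, -a, a ^ 2, -l * a - a ^ 3, 0, 0, 0, 0], fun h0 => ?_, fun y => ?_⟩
  · simpa using congrFun h0 0
  · simp [pencil, coeff₁, coeff₂]
    linear_combination (-y 7) * h

theorem pencil_eq (a b : ℂ) (u v : GLam l) :
    pencil l a b u.1 v.1 = a * ⁅u, v⁆.2 0 + b * ⁅u, v⁆.2 1 := rfl

theorem map_fst_eq_zero {l m : ℂ} (F : GLam l ≃ₗ⁅ℂ⁆ GLam m) {u : GLam l} (hu : u.1 = 0) :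
    (F u).1 = 0 :=
  fst_eq_zero_of_lie fun v => by
    rw [← F.apply_symm_apply v, ← LieEquiv.map_lie, lie_eq_zero_of_fst hu, map_zero]

theorem eq_Z_of_fst {u : GLam l} (hu : u.1 = 0) : u = u.2 0 • Z l 0 + u.2 1 • Z l 1 := by
  refine ext_coord (fun i => ?_) ?_ ?_ <;> simp [hu]

/-- An isomorphism `g_l ≃ g_m` gives a linear substitution mapping zeros of one quartic to zeros of
the other. -/
theorem exists_substitution {l m : ℂ} (F : GLam l ≃ₗ⁅ℂ⁆ GLam m) :
    ∃ p q r s : ℂ, p * s - q * r ≠ 0 ∧ ∀ a : ℂ, a ^ 4 + l * a ^ 2 + 1 = 0 →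
      (a * p + q) ^ 4 + m * (a * p + q) ^ 2 * (a * r + s) ^ 2 + (a * r + s) ^ 4 = 0 := by
  have hG : ∀ i, F.symm (Z m i) = (F.symm (Z m i)).2 0 • Z l 0 + (F.symm (Z m i)).2 1 • Z l 1 :=
    fun i => eq_Z_of_fst (map_fst_eq_zero F.symm rfl)
  have hF : ∀ i, F (Z l i) = (F (Z l i)).2 0 • Z m 0 + (F (Z l i)).2 1 • Z m 1 :=
    fun i => eq_Z_of_fst (map_fst_eq_zero F rfl)
  -- The matrix of `F.symm` on the centre; it pulls the functional `(a, 1)` back to `(a * p + q, a *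
  -- r + s)`.
  set p := (F.symm (Z m 0)).2 0
  set q := (F.symm (Z m 0)).2 1
  set r := (F.symm (Z m 1)).2 0
  set s := (F.symm (Z m 1)).2 1
  refine ⟨p, q, r, s, fun hd => ?_, fun a ha => ?_⟩
  · have h0 := F.apply_symm_apply (Z m 0)
    have h1 := F.apply_symm_apply (Z m 1)
    rw [hG, map_add, map_smul, map_smul, hF, hF 1] at h0 h1
    have h00 := congrArg (fun w : GLam m => w.2 0) h0
    have h01 := congrArg (fun w : GLam m => w.2 1) h0
    have h10 := congrArg (fun w : GLam m => w.2 0) h1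
    have h11 := congrArg (fun w : GLam m => w.2 1) h1
    simp only [add_snd, smul_snd, Z_snd, Pi.single_eq_same] at h00 h01 h10 h11
    simp at h00 h01 h10 h11
    grind
  · obtain ⟨x, hx, hxy⟩ := exists_pencil_of_quartic ha
    let u : GLam l := (x, 0)
    refine quartic_eq_zero_of_pencil (x := (F u).1) (fun h0 => hx ?_) fun y => ?_
    · have := map_fst_eq_zero F.symm h0
      rwa [F.symm_apply_apply] at this
    · let v : GLam m := (y, 0)
      have hv := hxy (F.symm v).1
      change pencil l a 1 u.1 (F.symm v).1 = 0 at hv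
      change pencil m _ _ (F u).1 v.1 = 0
      rw [pencil_eq] at hv ⊢
      have e : F.symm ⁅F u, v⁆ = ⁅u, F.symm v⁆ := by rw [LieEquiv.map_lie, F.symm_apply_apply]
      rw [← e, eq_Z_of_fst (u := ⁅F u, v⁆) rfl, map_add, map_smul, map_smul, hG 0, hG 1] at hv
      simp at hv
      simp
      linear_combination hv

/-- The quartics of `1 + i` and `1 - i` have different `j`-invariants. -/
theorem exists_not_equiv_conj :
    ∃ l : ℂ, ¬ Nonempty (GLam l ≃ₗ⁅ℂ⁆ GLam (starRingEnd ℂ l)) := by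
  refine ⟨1 + Complex.I, fun ⟨F⟩ => ?_⟩
  obtain ⟨p, q, r, s, hd, H⟩ := exists_substitution F
  set l : ℂ := 1 + Complex.I with hl
  have hm : starRingEnd ℂ l = 1 - Complex.I := by simp [hl, sub_eq_add_neg]
  rw [hm] at H
  set m : ℂ := 1 - Complex.I with hm'
  have hI : Complex.I ^ 2 = -1 := Complex.I_sq
  -- The quartic is even and palindromic, so its roots are `±α` and `±α⁻¹`, with `α ^ 2` a root of
  -- `y ^ 2 + l * y + 1`. They are distinct because `α ^ 4 ≠ 1`.
  obtain ⟨t, ht⟩ := IsAlgClosed.exists_eq_mul_self (l ^ 2 - 4)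
  obtain ⟨α, hα⟩ := IsAlgClosed.exists_eq_mul_self ((-l + t) / 2)
  have hα4 : α ^ 4 + l * α ^ 2 + 1 = 0 := by
    grind
  have hα0 : α ≠ 0 := by rintro rfl; norm_num at hα4
  have hα1 : α ^ 4 ≠ 1 := by
    intro h
    have h1 : l * α ^ 2 = -2 := by linear_combination hα4 - h
    have h2 : l ^ 2 = 4 := by
      have : l ^ 2 * α ^ 4 = 4 := by linear_combination (l * α ^ 2 - 2) * h1
      rwa [h, mul_one] at this
    have := congrArg Complex.re h2
    simp [hl, pow_two] at this
  -- Coefficients of the substituted quartic in `a`. Vanishing at four distinct points will force it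
  -- to be `A * (a ^ 4 + l * a ^ 2 + 1)`.
  obtain ⟨A, hA⟩ : ∃ A, A = p ^ 4 + m * p ^ 2 * r ^ 2 + r ^ 4 := ⟨_, rfl⟩
  obtain ⟨B, hB⟩ : ∃ B, B = 4 * p ^ 3 * q + m * (2 * p * q * r ^ 2 + 2 * p ^ 2 * r * s)
    + 4 * r ^ 3 * s := ⟨_, rfl⟩
  obtain ⟨C, hC⟩ : ∃ C, C = 6 * p ^ 2 * q ^ 2 + m * (p ^ 2 * s ^ 2 + q ^ 2 * r ^ 2
    + 4 * p * q * r * s) + 6 * r ^ 2 * s ^ 2 := ⟨_, rfl⟩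
  obtain ⟨D, hD⟩ : ∃ D, D = 4 * p * q ^ 3 + m * (2 * p * q * s ^ 2 + 2 * q ^ 2 * r * s)
    + 4 * r * s ^ 3 := ⟨_, rfl⟩
  obtain ⟨E, hE⟩ : ∃ E, E = q ^ 4 + m * q ^ 2 * s ^ 2 + s ^ 4 := ⟨_, rfl⟩
  have G : ∀ a : ℂ, a ^ 4 + l * a ^ 2 + 1 = 0 →
      A * a ^ 4 + B * a ^ 3 + C * a ^ 2 + D * a + E = 0 := by
    intro a ha
    rw [hA, hB, hC, hD, hE]
    linear_combination H a ha
  have g1 := G α hα4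
  have g2 := G (-α) (by linear_combination hα4)
  have hi : (α⁻¹) ^ 4 + l * (α⁻¹) ^ 2 + 1 = 0 := by
    field_simp; linear_combination hα4
  have g3 := G α⁻¹ hi
  have g4 := G (-α⁻¹) (by linear_combination hi)
  field_simp at g3 g4
  have k1 : A * α ^ 4 + C * α ^ 2 + E = 0 := by linear_combination (g1 + g2) / 2
  have k2 : B * α ^ 2 + D = 0 := by
    apply (mul_eq_zero.mp _).resolve_left hα0; linear_combination (g1 - g2) / 2
  have k3 : E * α ^ 4 + C * α ^ 2 + A = 0 := by
    linear_combination (g3 + g4) / 2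
  have k4 : D * α ^ 2 + B = 0 := by
    apply (mul_eq_zero.mp _).resolve_left hα0; linear_combination (g3 - g4) / 2
  have hα1' : α ^ 4 - 1 ≠ 0 := sub_ne_zero.mpr hα1
  have hEA : E = A := by
    apply sub_eq_zero.mp; apply (mul_eq_zero.mp _).resolve_left hα1'
    linear_combination k3 - k1
  have hB0 : B = 0 := by
    apply (mul_eq_zero.mp _).resolve_left hα1'
    linear_combination α ^ 2 * k2 - k4
  have hD0 : D = 0 := by rw [hB0] at k2; linear_combination k2
  have hCA : C = A * l := by
    have : α ^ 2 ≠ 0 := pow_ne_zero 2 hα0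
    apply sub_eq_zero.mp; apply (mul_eq_zero.mp _).resolve_left this
    rw [hEA] at k1
    linear_combination k1 - A * hα4
  -- The two classical invariants of a binary quartic, scaling by the 4th and 6th powers of the
  -- determinant.
  have inv1 : 12 * A * E - 3 * B * D + C ^ 2 = (p * s - q * r) ^ 4 * (12 + m ^ 2) := by
    rw [hA, hB, hC, hD, hE]; ring
  have inv2 : 72 * A * C * E + 9 * B * C * D - 27 * A * D ^ 2 - 27 * E * B ^ 2 - 2 * C ^ 3
      = (p * s - q * r) ^ 6 * (72 * m - 2 * m ^ 3) := by
    rw [hA, hB, hC, hD, hE]; ring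
  rw [hEA, hB0, hD0, hCA] at inv1 inv2
  set d := p * s - q * r with hdd
  have i1 : A ^ 2 * (12 + l ^ 2) = d ^ 4 * (12 + m ^ 2) := by linear_combination inv1
  have i2 : A ^ 3 * (72 * l - 2 * l ^ 3) = d ^ 6 * (72 * m - 2 * m ^ 3) := by
    linear_combination inv2
  have hm2 : m ^ 2 = -2 * Complex.I := by rw [hm']; linear_combination hI
  have hl2 : l ^ 2 = 2 * Complex.I := by rw [hl]; linear_combination hI
  have hA0 : A ≠ 0 := by
    rintro rfl
    rw [hm2] at i1
    have := (mul_eq_zero.mp (i1.symm.trans (by ring))).resolve_left (pow_ne_zero 4 hd)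
    have := congrArg Complex.re this
    simp at this
  -- Cube of the first invariant against square of the second: `A` and `d` cancel.
  have i3 : (12 + l ^ 2) ^ 3 * (72 * m - 2 * m ^ 3) ^ 2
      = (12 + m ^ 2) ^ 3 * (72 * l - 2 * l ^ 3) ^ 2 := by
    have : A ^ 6 * d ^ 12 ≠ 0 := mul_ne_zero (pow_ne_zero 6 hA0) (pow_ne_zero 12 hd)
    apply mul_left_cancel₀ this
    have j1 : A ^ 6 * (12 + l ^ 2) ^ 3 = d ^ 12 * (12 + m ^ 2) ^ 3 := by
      calc _ = (A ^ 2 * (12 + l ^ 2)) ^ 3 := by ring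
        _ = _ := by rw [i1]; ring
    have j2 : A ^ 6 * (72 * l - 2 * l ^ 3) ^ 2 = d ^ 12 * (72 * m - 2 * m ^ 3) ^ 2 := by
      calc _ = (A ^ 3 * (72 * l - 2 * l ^ 3)) ^ 2 := by ring
        _ = _ := by rw [i2]; ring
    calc _ = (A ^ 6 * (12 + l ^ 2) ^ 3) * (d ^ 12 * (72 * m - 2 * m ^ 3) ^ 2) := by ring
      _ = _ := by rw [j1, ← j2]; ring
  have e1 : (72 * m - 2 * m ^ 3) ^ 2 = m ^ 2 * (72 - 2 * m ^ 2) ^ 2 := by ring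
  have e2 : (72 * l - 2 * l ^ 3) ^ 2 = l ^ 2 * (72 - 2 * l ^ 2) ^ 2 := by ring
  rw [e1, e2, hm2, hl2] at i3
  have := congrArg Complex.im i3
  simp [pow_succ] at this
  norm_num at this

/-! ### Direct sums: centroid, uniqueness of summands, complex structures. -/

section DirectSum

variable {ι : Type} {μ ν : ι → ℂ}

theorem directSum_lie_congr {x x' y y' : ⨁ i, GLam (μ i)} (hx : ∀ i, (x i).1 = (x' i).1)
    (hy : ∀ i, (y i).1 = (y' i).1) : ⁅x, y⁆ = ⁅x', y'⁆ :=
  DFinsupp.ext fun i => by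
    rw [DirectSum.bracket_apply, DirectSum.bracket_apply, lie_congr (hx i) (hy i)]

theorem directSum_lie_lie_eq_zero (x y z : ⨁ i, GLam (μ i)) : ⁅x, ⁅y, z⁆⁆ = 0 :=
  DFinsupp.ext fun i => by
    rw [DirectSum.bracket_apply, DirectSum.bracket_apply, lie_lie_eq_zero]; rfl

theorem exists_directSum_lie_eq [Finite ι] {x : ⨁ i, GLam (μ i)} (hx : ∀ i, (x i).1 = 0) :
    ∃ y z : ⨁ i, GLam (μ i), ⁅y, z⁆ = x := by
  have := Fintype.ofFinite ι
  choose v w h using fun i => exists_lie_eq (hx i)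
  refine ⟨DFinsupp.equivFunOnFintype.symm v, DFinsupp.equivFunOnFintype.symm w,
    DFinsupp.ext fun i => ?_⟩
  rw [DirectSum.bracket_apply, ← h i]
  rfl

variable [DecidableEq ι]

theorem of_lie (x : ⨁ i, GLam (μ i)) (i : ι) (v : GLam (μ i)) :
    ⁅x, DirectSum.of (fun i => GLam (μ i)) i v⁆ = DirectSum.of (fun i => GLam (μ i)) i ⁅x i, v⁆ := by
  refine DFinsupp.ext fun j => ?_
  rw [DirectSum.bracket_apply]
  by_cases h : i = j
  · subst h; simp
  · rw [DirectSum.of_eq_of_ne _ _ _ (Ne.symm h), DirectSum.of_eq_of_ne _ _ _ (Ne.symm h), lie_zero]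

theorem isTwoStepNilpotent_directSum [Nonempty ι] (μ : ι → ℂ) :
    IsTwoStepNilpotent (⨁ i, GLam (μ i)) := by
  obtain ⟨i⟩ := ‹Nonempty ι›
  refine isTwoStepNilpotent_of_lie directSum_lie_lie_eq_zero
    (x := DirectSum.of (fun i => GLam (μ i)) i (X _ 0))
    (y := DirectSum.of (fun i => GLam (μ i)) i (X _ 4)) fun h => ?_
  have := congrArg (fun x : ⨁ i, GLam (μ i) => (x i).2 0) h
  rw [DirectSum.lie_of_same, (bracket_basis _).1] at this
  simp at this

variable [Fintype ι]

/-- Modulo the centre, and on the centre, the centroid of `⨁ g_{μ i}` consists of blockwise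
scalars. -/
theorem exists_scalars_of_centroid (T : (⨁ i, GLam (μ i)) → ⨁ i, GLam (μ i))
    (hT : ∀ x y : ⨁ i, GLam (μ i), T ⁅x, y⁆ = ⁅T x, y⁆) :
    ∃ c : ι → ℂ, ∀ m, (∀ x, (T x m).1 = c m • (x m).1) ∧
      ∀ x : ⨁ i, GLam (μ i), (∀ i, (x i).1 = 0) → T x m = c m • x m := by
  -- Bracketing with a vector of block `m` sees only that block, so `T` induces a centroid map `D m`
  -- there.
  let D : ∀ m, GLam (μ m) → GLam (μ m) := fun m u => T (DirectSum.of (fun i => GLam (μ i)) m u) m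
  have hD : ∀ x m (v : GLam (μ m)), D m ⁅x m, v⁆ = ⁅T x m, v⁆ := by
    intro x m v
    have := hT x (DirectSum.of (fun i => GLam (μ i)) m v)
    rw [of_lie, of_lie] at this
    change T _ m = _
    rw [this, DirectSum.of_eq_same]
  have hD' : ∀ m (u v : GLam (μ m)), D m ⁅u, v⁆ = ⁅D m u, v⁆ := by
    intro m u v
    have := hD (DirectSum.of (fun i => GLam (μ i)) m u) m v
    rwa [DirectSum.of_eq_same] at this
  choose c hc using fun m => exists_scalar_of_centroid (D m) (hD' m)
  have h1 : ∀ m x, (T x m).1 = (c m • x m).1 := fun m x => fst_eq_of_lie fun v => by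
    rw [← hD, (hc m).2 _ rfl, smul_lie]
  refine ⟨c, fun m => ⟨h1 m, fun x hx => ?_⟩⟩
  obtain ⟨y, z, rfl⟩ := exists_directSum_lie_eq hx
  rw [hT, DirectSum.bracket_apply, DirectSum.bracket_apply, lie_congr (h1 m y) rfl, smul_lie]

/-- The summands of a direct sum are determined up to isomorphism. -/
theorem exists_injective_of_equiv (F : (⨁ i, GLam (μ i)) ≃ₗ⁅ℂ⁆ ⨁ i, GLam (ν i)) :
    ∃ σ : ι → ι, Function.Injective σ ∧
      ∀ m, Nonempty (GLam (ν m) ≃ₗ⁅ℂ⁆ GLam (μ (σ m))) := by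
  -- The block projections, which lie in the centroid, transported by `F`.
  let T : ι → (⨁ i, GLam (ν i)) → ⨁ i, GLam (ν i) := fun j x =>
    F (DirectSum.of (fun i => GLam (μ i)) j (F.symm x j))
  have hT : ∀ j (x y : ⨁ i, GLam (ν i)), T j ⁅x, y⁆ = ⁅T j x, y⁆ := by
    intro j x y
    have : ⁅DirectSum.of (fun i => GLam (μ i)) j (F.symm x j), F.symm y⁆ =
        DirectSum.of (fun i => GLam (μ i)) j (F.symm ⁅x, y⁆ j) := by
      rw [← lie_skew, of_lie, ← map_neg, lie_skew, LieEquiv.map_lie, DirectSum.bracket_apply]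
    change F _ = ⁅F _, y⁆
    rw [← this, LieEquiv.map_lie, F.apply_symm_apply]
  choose c hc using fun j => exists_scalars_of_centroid (T j) (hT j)
  have hsum : ∀ x, ∑ j, T j x = x := by
    intro x
    change ∑ j, F _ = x
    rw [← map_sum, DirectSum.sum_univ_of, F.apply_symm_apply]
  have hex : ∀ m, ∃ j, c j m ≠ 0 := by
    intro m
    by_contra! h
    have h0 := congrArg (fun x : ⨁ i, GLam (ν i) => (x m).1 0)
      (hsum (DirectSum.of (fun i => GLam (ν i)) m (X _ 0)))
    have hfst : ∀ (s : Finset ι) (f : ι → ⨁ i, GLam (ν i)),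
        ((∑ j ∈ s, f j) m).1 0 = ∑ j ∈ s, (f j m).1 0 := by
      intro s f
      induction s using Finset.induction_on with
      | empty => simp
      | insert a s ha ih => rw [Finset.sum_insert ha, Finset.sum_insert ha, ← ih]; rfl
    simp only [hfst] at h0
    rw [Finset.sum_eq_zero fun j _ => by rw [(hc j m).1, h j]; simp] at h0
    simp at h0
  choose σ hσ using hex
  let a : ∀ m, GLam (ν m) →ₗ⁅ℂ⁆ GLam (μ (σ m)) := fun m =>
    (DirectSum.lieAlgebraComponent ℂ ι (fun i => GLam (μ i)) (σ m)).comp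
      ((F.symm : (⨁ i, GLam (ν i)) →ₗ⁅ℂ⁆ ⨁ i, GLam (μ i)).comp
        (DirectSum.lieAlgebraOf ℂ ι (fun i => GLam (ν i)) m))
  have ha : ∀ m u, a m u = F.symm (DirectSum.of (fun i => GLam (ν i)) m u) (σ m) :=
    fun m u => rfl
  -- A kernel element is killed by `T (σ m)`, which acts on block `m` by a nonzero scalar modulo the
  -- centre and on it: the element is first central, then zero.
  have hinj : ∀ m, Function.Bijective (a m) := by
    refine fun m => bijective_of_injective _ ((injective_iff_map_eq_zero _).mpr fun u hu => ?_)
    have h0 : T (σ m) (DirectSum.of (fun i => GLam (ν i)) m u) = 0 := by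
      change F (DirectSum.of (fun i => GLam (μ i)) (σ m) _) = 0
      rw [← ha, hu, map_zero, map_zero]
    have h1 := (hc (σ m) m).1 (DirectSum.of (fun i => GLam (ν i)) m u)
    rw [h0, DirectSum.of_eq_same] at h1
    have h2 : u.1 = 0 := (smul_eq_zero.mp h1.symm).resolve_left (hσ m)
    have h3 := (hc (σ m) m).2 (DirectSum.of (fun i => GLam (ν i)) m u) fun i => by
      by_cases hi : m = i
      · subst hi; rw [DirectSum.of_eq_same]; exact h2
      · rw [DirectSum.of_eq_of_ne _ _ _ (Ne.symm hi)]; rfl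
    rw [h0, DirectSum.of_eq_same] at h3
    exact (smul_eq_zero.mp h3.symm).resolve_left (hσ m)
  refine ⟨σ, fun m m' h => ?_, fun m => ⟨LieEquiv.ofBijective (a m) (hinj m)⟩⟩
  by_contra hne
  -- Distinct blocks commute, so two of them mapping onto one target block would make it abelian. A
  -- free index `j` avoids transport along `σ m = σ m'`.
  have hsurj : ∀ j, σ m' = j → ∀ v : GLam (μ j),
      ∃ w, F.symm (DirectSum.of (fun i => GLam (ν i)) m' w) j = v := by
    rintro _ rfl v
    exact (hinj m').2 v
  have hcomm : ∀ (j : ι), σ m = j → σ m' = j → ∀ u v : GLam (μ j), ⁅u, v⁆ = 0 := by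
    rintro j rfl hj u v
    obtain ⟨u, rfl⟩ := (hinj m).2 u
    obtain ⟨v, rfl⟩ : ∃ w, F.symm (DirectSum.of (fun i => GLam (ν i)) m' w) (σ m) = v := by
      exact hsurj _ hj v
    rw [ha, ← DirectSum.bracket_apply, ← LieEquiv.map_lie, DirectSum.lie_of_of_ne _ hne, map_zero]
    rfl
  have := congrArg (fun w : GLam (μ (σ m)) => w.2 0)
    ((bracket_basis _).1.symm.trans (hcomm _ rfl h.symm (X _ 0) (X _ 4)))
  simp at this

/-- If a complex Lie algebra has the same realification as `⨁ g_l`, its multiplication by `i`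
becomes, after changing the isomorphism, multiplication by `i` or `-i` on each summand. -/
theorem exists_blockwise_form {h : Type} [LieRing h] [LieAlgebra ℂ h]
    (g : h ≃+ ⨁ _ : ι, GLam l) (hg : ∀ x y, g ⁅x, y⁆ = ⁅g x, g y⁆)
    (hr : ∀ (r : ℝ) (x : h), g ((r : ℂ) • x) = (r : ℂ) • g x) :
    ∃ c : ι → ℂ, (∀ m, c m = Complex.I ∨ c m = -Complex.I) ∧
      ∃ f : h ≃+ ⨁ _ : ι, GLam l, (∀ x y, f ⁅x, y⁆ = ⁅f x, f y⁆) ∧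
        (∀ (r : ℝ) (x : h), f ((r : ℂ) • x) = (r : ℂ) • f x) ∧
        ∀ (x : h) m, f (Complex.I • x) m = c m • f x m := by
  have hII : ∀ x : h, Complex.I • Complex.I • x = -x := fun x => by
    rw [smul_smul, Complex.I_mul_I, neg_one_smul]
  obtain ⟨c, hc⟩ := exists_scalars_of_centroid (μ := fun _ : ι => l)
    (fun x => g (Complex.I • g.symm x)) fun x y => by
      change g _ = ⁅g _, y⁆
      have : g.symm ⁅x, y⁆ = ⁅g.symm x, g.symm y⁆ := by
        apply g.injective
        rw [hg, g.apply_symm_apply, g.apply_symm_apply, g.apply_symm_apply]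
      rw [this, ← smul_lie, hg, g.apply_symm_apply]
  have h1 : ∀ (x : h) m, (g (Complex.I • x) m).1 = c m • (g x m).1 := fun x m => by
    have := (hc m).1 (g x)
    rwa [g.symm_apply_apply] at this
  have h2 : ∀ (x : h), (∀ i, (g x i).1 = 0) → ∀ m, g (Complex.I • x) m = c m • g x m :=
    fun x hx m => by
      have := (hc m).2 (g x) hx
      rwa [g.symm_apply_apply] at this
  have hcc : ∀ m, c m * c m = -1 := by
    intro m
    have e := h1 (Complex.I • g.symm (DirectSum.of (fun _ => GLam l) m (X l 0))) m
    rw [hII, h1, map_neg, g.apply_symm_apply] at e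
    have e0 := congrFun e 0
    rw [DFinsupp.neg_apply, DirectSum.of_eq_same] at e0
    simp at e0
    exact e0.symm
  let E : (⨁ _ : ι, GLam l) →+ ⨁ _ : ι, GLam l :=
    DFinsupp.mapRange.addMonoidHom fun m => DistribSMul.toAddMonoidHom (GLam l) (c m)
  have hE : ∀ x m, E x m = c m • x m := fun x m => rfl
  let J : h →+ h := DistribSMul.toAddMonoidHom h Complex.I
  -- Multiplication by `i` may differ from the blockwise scalar `E` by central terms. Since `E² =
  -- -1`, the average of `g` and `-E g J` intertwines `J` with `E`; it equals `g` modulo the centre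
  -- and on the centre, hence stays bijective and bracket-preserving.
  let f₀ : h →+ ⨁ _ : ι, GLam l :=
    (DistribSMul.toAddMonoidHom (⨁ _ : ι, GLam l) (2⁻¹ : ℂ)).comp
      (g.toAddMonoidHom - E.comp (g.toAddMonoidHom.comp J))
  have hf₀ : ∀ x m, f₀ x m = (2⁻¹ : ℂ) • (g x m - c m • g (Complex.I • x) m) := fun x m => rfl
  have hfst : ∀ x m, (f₀ x m).1 = (g x m).1 := by
    intro x m
    have e : (f₀ x m).1 = (2⁻¹ : ℂ) • ((g x m).1 - c m • (g (Complex.I • x) m).1) := rfl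
    rw [e, h1, smul_smul, hcc, neg_one_smul, sub_neg_eq_add, ← two_smul ℂ, smul_smul]
    norm_num
  have hcen : ∀ x, (∀ i, (g x i).1 = 0) → f₀ x = g x := by
    intro x hx
    refine DFinsupp.ext fun m => ?_
    rw [hf₀, h2 x hx, smul_smul, hcc, neg_one_smul, sub_neg_eq_add, ← two_smul ℂ, smul_smul]
    norm_num
  have hbij : Function.Bijective f₀ := by
    constructor
    · refine (injective_iff_map_eq_zero _).mpr fun x hx => ?_
      have : ∀ i, (g x i).1 = 0 := fun i => by rw [← hfst, hx]; rfl
      rw [hcen x this] at hx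
      exact g.map_eq_zero_iff.mp hx
    · intro v
      refine ⟨g.symm v - g.symm (f₀ (g.symm v) - v), ?_⟩
      rw [map_sub, hcen (g.symm (f₀ (g.symm v) - v)), g.apply_symm_apply, sub_sub_cancel]
      intro i
      rw [g.apply_symm_apply]
      change (f₀ (g.symm v) i).1 - (v i).1 = 0
      rw [hfst, g.apply_symm_apply, sub_self]
  refine ⟨c, fun m => ?_, AddEquiv.ofBijective f₀ hbij, fun x y => ?_, fun r x => ?_,
    fun x m => ?_⟩
  · have : (c m - Complex.I) * (c m + Complex.I) = 0 := by
      linear_combination hcc m - Complex.I_mul_I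
    rcases mul_eq_zero.mp this with h | h
    · exact .inl (sub_eq_zero.mp h)
    · exact .inr (eq_neg_of_add_eq_zero_left h)
  · change f₀ _ = ⁅f₀ x, f₀ y⁆
    rw [hcen, hg]
    · exact (directSum_lie_congr (hfst x) (hfst y)).symm
    · intro i
      rw [hg]; rfl
  · change f₀ _ = (r : ℂ) • f₀ x
    refine DFinsupp.ext fun m => ?_
    change f₀ _ m = (r : ℂ) • f₀ x m
    rw [hf₀, hf₀, smul_comm Complex.I, hr, hr]
    change (2⁻¹ : ℂ) • ((r : ℂ) • g x m - c m • (r : ℂ) • g (Complex.I • x) m) = _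
    rw [smul_comm (c m), ← smul_sub, smul_comm (2⁻¹ : ℂ)]
  · change f₀ _ m = c m • f₀ x m
    rw [hf₀, hf₀, hII, smul_comm (c m), map_neg]
    congr 1
    rw [smul_sub, smul_smul, hcc, neg_one_smul, DFinsupp.neg_apply, smul_neg]
    abel

end DirectSum

/-! ### Mixed sums and the count of complex structures. -/

/-- The identity if `p` holds, and complex conjugation otherwise. -/
noncomputable def idOrConj (p : Prop) [Decidable p] : ℂ ≃+* ℂ :=
  if p then RingEquiv.refl ℂ else Complex.conjAe.toRingEquiv

theorem idOrConj_ofReal (p : Prop) [Decidable p] (r : ℝ) : idOrConj p r = r := by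
  unfold idOrConj; split_ifs <;> simp

theorem idOrConj_pos {p : Prop} [Decidable p] (h : p) (z : ℂ) : idOrConj p z = z := by
  simp [idOrConj, h]

theorem idOrConj_neg {p : Prop} [Decidable p] (h : ¬ p) (z : ℂ) :
    idOrConj p z = starRingEnd ℂ z := by
  simp [idOrConj, h]

/-- The direct sum of `a` copies of `g_l` and `k - a` copies of `g_{l̄}`. -/
noncomputable def mixedSum (l : ℂ) (k a : ℕ) : ComplexLieAlgebra where
  carrier := ⨁ j : Fin k, GLam (idOrConj (j.val < a) l)

/-- Coordinatewise conjugation on some summands. -/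
noncomputable def conjSum (l : ℂ) (k a : ℕ) :
    (⨁ _ : Fin k, GLam l) ≃+ ⨁ j : Fin k, GLam (idOrConj (j.val < a) l) :=
  DFinsupp.mapRange.addEquiv fun j => conjMap (idOrConj (j.val < a)) l

theorem conjSum_apply (l : ℂ) (k a : ℕ) (x : ⨁ _ : Fin k, GLam l) (j : Fin k) :
    conjSum l k a x j = conjMap (idOrConj (j.val < a)) l (x j) := rfl

theorem conjSum_lie (l : ℂ) (k a : ℕ) (x y : ⨁ _ : Fin k, GLam l) :
    conjSum l k a ⁅x, y⁆ = ⁅conjSum l k a x, conjSum l k a y⁆ :=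
  DFinsupp.ext fun j => by
    rw [DirectSum.bracket_apply, conjSum_apply, DirectSum.bracket_apply, conjMap_lie]; rfl

theorem conjSum_real_smul (l : ℂ) (k a : ℕ) (r : ℝ) (x : ⨁ _ : Fin k, GLam l) :
    conjSum l k a ((r : ℂ) • x) = (r : ℂ) • conjSum l k a x :=
  DFinsupp.ext fun j => by
    change conjMap (idOrConj (j.val < a)) l ((r : ℂ) • x j) =
      (r : ℂ) • conjMap (idOrConj (j.val < a)) l (x j)
    rw [conjMap_smul, idOrConj_ofReal]

theorem mixedSum_isComplexStructureOn (l : ℂ) (k a : ℕ) :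
    (mixedSum l k a).IsComplexStructureOn (Realification (⨁ _ : Fin k, GLam l)) := by
  have : Nonempty (Realification (⨁ _ : Fin k, GLam l) ≃ₗ⁅ℝ⁆
      Realification (mixedSum l k a).carrier) :=
    nonempty_realification_equiv_iff.mpr
      ⟨conjSum l k a, conjSum_lie l k a, conjSum_real_smul l k a⟩
  exact this.map LieEquiv.symm

theorem nonempty_realification_conj (l : ℂ) :
    Nonempty (Realification (GLam l) ≃ₗ⁅ℝ⁆ Realification (GLam (starRingEnd ℂ l))) :=
  nonempty_realification_equiv_iff.mpr ⟨conjMap Complex.conjAe.toRingEquiv l, conjMap_lie _,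
    fun r x => (conjMap_smul _ _ _).trans
      (congrArg (· • conjMap Complex.conjAe.toRingEquiv l x) (Complex.conj_ofReal r))⟩

/-- A real Lie isomorphism commuting with `i` is complex linear. -/
theorem nonempty_equiv_of_smul_I {h h' : Type} [LieRing h] [LieAlgebra ℂ h] [LieRing h']
    [LieAlgebra ℂ h'] (f : h ≃+ h') (hf : ∀ x y, f ⁅x, y⁆ = ⁅f x, f y⁆)
    (hr : ∀ (r : ℝ) (x : h), f ((r : ℂ) • x) = (r : ℂ) • f x)
    (hI : ∀ x, f (Complex.I • x) = Complex.I • f x) : Nonempty (h ≃ₗ⁅ℂ⁆ h') := by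
  let F : h →ₗ⁅ℂ⁆ h' :=
    { toFun := f
      map_add' := f.map_add
      map_smul' := fun z x => by
        rw [← Complex.re_add_im z, RingHom.id_apply, add_smul, add_smul, map_add, hr, mul_smul,
          mul_smul, hr, hI]
      map_lie' := hf _ _ }
  exact ⟨LieEquiv.ofBijective F f.bijective⟩

theorem card_val_lt {k a : ℕ} (ha : a ≤ k) : Fintype.card {j : Fin k // j.val < a} = a := by
  have e : {j : Fin k // j.val < a} ≃ Fin a :=
    { toFun j := ⟨j.1, j.2⟩
      invFun i := ⟨⟨i, i.2.trans_le ha⟩, i.2⟩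
      left_inv _ := rfl
      right_inv _ := rfl }
  rw [Fintype.card_congr e, Fintype.card_fin]

/-- Every complex Lie algebra with the realification of `g_l^{⊕ k}` is a sum of copies of `g_l` and
of `g_{l̄}`. -/
theorem exists_equiv_mixedSum {l : ℂ} {k : ℕ} (h : ComplexLieAlgebra)
    (hh : h.IsComplexStructureOn (Realification (⨁ _ : Fin k, GLam l))) :
    ∃ a ≤ k, Nonempty (h.carrier ≃ₗ⁅ℂ⁆ (mixedSum l k a).carrier) := by
  classical
  obtain ⟨g, hg, hr⟩ := nonempty_realification_equiv_iff.mp hh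
  obtain ⟨c, hc, f, hf, hfr, hfI⟩ := exists_blockwise_form g hg hr
  set a := Fintype.card {m // c m = Complex.I} with ha
  have hak : a ≤ k := by simpa using Fintype.card_subtype_le fun m => c m = Complex.I
  obtain ⟨e⟩ : Nonempty ({m // c m = Complex.I} ≃ {j : Fin k // j.val < a}) :=
    ⟨Fintype.equivOfCardEq (by rw [card_val_lt hak])⟩
  -- A permutation moving the blocks with scalar `i` to the first `a` places; the remaining blocks
  -- get conjugated.
  let π := e.extendSubtype
  have hπ : ∀ m, (π m).val < a ↔ c m = Complex.I := fun m =>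
    ⟨fun h => by_contra fun hn => e.extendSubtype_not_mem m hn h, fun h => e.extendSubtype_mem m h⟩
  let R : (⨁ _ : Fin k, GLam l) ≃+ ⨁ _ : Fin k, GLam l := DirectSum.equivCongrLeft π
  have hR : ∀ x j, R x j = x (π.symm j) := fun x j => DirectSum.equivCongrLeft_apply π x j
  refine ⟨a, hak, nonempty_equiv_of_smul_I (h' := ⨁ j : Fin k, GLam (idOrConj (j.val < a) l))
    ((f.trans R).trans (conjSum l k a)) (fun x y => ?_) (fun r x => ?_) fun x => ?_⟩
  · change conjSum l k a (R (f _)) = ⁅conjSum l k a (R (f x)), conjSum l k a (R (f y))⁆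
    rw [← conjSum_lie, hf]
    congr 1
    refine DFinsupp.ext fun j => ?_
    rw [hR, DirectSum.bracket_apply, DirectSum.bracket_apply, hR, hR]
  · change conjSum l k a (R (f _)) = (r : ℂ) • conjSum l k a (R (f x))
    rw [← conjSum_real_smul, hfr]
    congr 1
    refine DFinsupp.ext fun j => ?_
    change R _ j = (r : ℂ) • R _ j
    rw [hR, hR]; rfl
  · refine DFinsupp.ext fun j => ?_
    change conjMap (idOrConj (j.val < a)) l (R (f _) j) =
      Complex.I • conjMap (idOrConj (j.val < a)) l (R (f x) j)
    rw [hR, hR, hfI, conjMap_smul]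
    congr 1
    by_cases hj : j.val < a
    · rw [idOrConj_pos hj]
      exact (hπ _).mp (by rwa [π.apply_symm_apply])
    · rw [idOrConj_neg hj, (hc (π.symm j)).resolve_left fun h => hj (by
        rw [← hπ, π.apply_symm_apply] at h; exact h)]
      simp

/-- Uniqueness of summands permutes the blocks; non-isomorphism of the two kinds forces the
permutation to preserve kinds, so their numbers agree. -/
theorem eq_of_mixedSum_equiv {l : ℂ} (hl : ¬ Nonempty (GLam l ≃ₗ⁅ℂ⁆ GLam (starRingEnd ℂ l)))
    {k a b : ℕ} (ha : a ≤ k) (hb : b ≤ k)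
    (h : Nonempty ((mixedSum l k a).carrier ≃ₗ⁅ℂ⁆ (mixedSum l k b).carrier)) : a = b := by
  obtain ⟨F⟩ := h
  obtain ⟨σ, hσ, H⟩ := exists_injective_of_equiv
    (μ := fun j : Fin k => idOrConj (j.val < a) l) (ν := fun j : Fin k => idOrConj (j.val < b) l) F
  have key : ∀ m, (σ m).val < a ↔ m.val < b := by
    intro m
    have hm := H m
    by_cases h1 : (σ m).val < a <;> by_cases h2 : m.val < b <;> simp only [h1, h2, iff_true]
    · rw [idOrConj_pos h1, idOrConj_neg h2] at hm
      exact absurd (hm.map LieEquiv.symm) hl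
    · rw [idOrConj_neg h1, idOrConj_pos h2] at hm
      exact absurd hm hl
  let π : Fin k ≃ Fin k := Equiv.ofBijective σ (Finite.injective_iff_bijective.mp hσ)
  rw [← card_val_lt ha, ← card_val_lt hb]
  exact (Fintype.card_congr (π.subtypeEquiv fun m => (key m).symm)).symm

theorem hasExactlyComplexStructures_directSum {l : ℂ}
    (hl : ¬ Nonempty (GLam l ≃ₗ⁅ℂ⁆ GLam (starRingEnd ℂ l))) (k : ℕ) :
    HasExactlyComplexStructures (Realification (⨁ _ : Fin k, GLam l)) (k + 1) := by
  refine ⟨fun i => mixedSum l k i, fun i => mixedSum_isComplexStructureOn l k i,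
    fun i j hij h => hij (Fin.ext ?_), fun h hh => ?_⟩
  · exact eq_of_mixedSum_equiv hl (Nat.lt_succ_iff.mp i.2) (Nat.lt_succ_iff.mp j.2) h
  · obtain ⟨a, ha, e⟩ := exists_equiv_mixedSum h hh
    exact ⟨⟨a, Nat.lt_succ_of_le ha⟩, e⟩

/-- For real `l` there is only one complex structure. -/
theorem hasExactlyComplexStructures_one {l : ℂ} (hl : starRingEnd ℂ l = l) (k : ℕ) :
    HasExactlyComplexStructures (Realification (⨁ _ : Fin k, GLam l)) 1 := by
  refine ⟨fun _ => mixedSum l k 0, fun _ => mixedSum_isComplexStructureOn l k 0,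
    fun i j hij => absurd (Subsingleton.elim i j) hij, fun h hh => ⟨0, ?_⟩⟩
  obtain ⟨a, ha, e⟩ := exists_equiv_mixedSum h hh
  -- For self-conjugate `l` all the mixed sums are literally equal.
  have : mixedSum l k a = mixedSum l k 0 := by
    have : ∀ b, (fun j : Fin k => idOrConj (j.val < b) l) = fun _ => l := fun b =>
      funext fun j => by unfold idOrConj; split_ifs <;> simp [hl]
    exact (congrArg (fun μ : Fin k → ℂ => (⟨⨁ j, GLam (μ j)⟩ : ComplexLieAlgebra))
      ((this a).trans (this 0).symm))
  rwa [this] at e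

/-- Nilpotency length here depends on the Lie ring alone, so restricting scalars changes nothing. -/
theorem isTwoStepNilpotent_realification (l : ℂ) {k : ℕ} (hk : 1 ≤ k) :
    IsTwoStepNilpotent (Realification (⨁ _ : Fin k, GLam l)) :=
  haveI : Nonempty (Fin k) := ⟨⟨0, hk⟩⟩
  isTwoStepNilpotent_directSum fun _ : Fin k => l

theorem finiteDimensional_realification (l : ℂ) (k : ℕ) :
    FiniteDimensional ℝ (Realification (⨁ _ : Fin k, GLam l)) :=
  (Module.Finite.trans (R := ℝ) ℂ (⨁ _ : Fin k, GLam l) :)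

end GLam

/-! ### Assembly of the four statements. -/

theorem mainTheorem3 :
    -- for every positive `n` there is a real `2`-step nilpotent Lie algebra with exactly `n`
    -- different bi-invariant complex structures
    (∀ n : ℕ, 1 ≤ n → ∃ (g : Type) (_ : LieRing g) (_ : LieAlgebra ℝ g),
      FiniteDimensional ℝ g ∧ IsTwoStepNilpotent g ∧ HasExactlyComplexStructures g n) ∧
    -- there is `l` such that `g_l` is not isomorphic to `g_{l̄}`
    (∃ l : ℂ, ¬ Nonempty (GLam l ≃ₗ⁅ℂ⁆ GLam (starRingEnd ℂ l))) ∧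
    -- for every such `l`, the realification of the sum of `k` copies of `g_l` has exactly
    -- `k + 1` bi-invariant complex structures, and is `2`-step nilpotent if `k` is positive
    (∀ l : ℂ, ¬ Nonempty (GLam l ≃ₗ⁅ℂ⁆ GLam (starRingEnd ℂ l)) → ∀ k : ℕ,
      HasExactlyComplexStructures (Realification (⨁ _ : Fin k, GLam l)) (k + 1) ∧
      (1 ≤ k → IsTwoStepNilpotent (Realification (⨁ _ : Fin k, GLam l)))) ∧
    -- there are non-isomorphic complex `2`-step nilpotent Lie algebras with isomorphic
    -- underlying real Lie algebras
    (∃ h₁ h₂ : ComplexLieAlgebra, FiniteDimensional ℂ h₁.carrier ∧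
      FiniteDimensional ℂ h₂.carrier ∧
      IsTwoStepNilpotent h₁.carrier ∧ IsTwoStepNilpotent h₂.carrier ∧
      ¬ Nonempty (h₁.carrier ≃ₗ⁅ℂ⁆ h₂.carrier) ∧
      Nonempty (Realification h₁.carrier ≃ₗ⁅ℝ⁆ Realification h₂.carrier)) := by
  obtain ⟨l₀, hl₀⟩ := GLam.exists_not_equiv_conj
  refine ⟨fun n hn => ?_, ⟨l₀, hl₀⟩, fun l hl k =>
    ⟨GLam.hasExactlyComplexStructures_directSum hl k,
      GLam.isTwoStepNilpotent_realification l⟩,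
    ⟨⟨GLam l₀⟩, ⟨GLam (starRingEnd ℂ l₀)⟩, inferInstanceAs (FiniteDimensional ℂ (GLam _)),
      inferInstanceAs (FiniteDimensional ℂ (GLam _)), GLam.isTwoStepNilpotent _,
      GLam.isTwoStepNilpotent _, hl₀, ?_⟩⟩
  · obtain rfl | ⟨k, rfl⟩ : n = 1 ∨ ∃ k, n = k + 1 + 1 := by
      obtain ⟨m, rfl⟩ := Nat.exists_eq_add_of_le' hn
      cases m with
      | zero => exact .inl rfl
      | succ k => exact .inr ⟨k, rfl⟩
    -- Zero copies would give the zero algebra, which is not `2`-step nilpotent; the self-conjugate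
    -- `g_0` serves for `n = 1`.
    · exact ⟨Realification (⨁ _ : Fin 1, GLam 0), inferInstance, inferInstance,
        GLam.finiteDimensional_realification 0 1, GLam.isTwoStepNilpotent_realification 0 le_rfl,
        GLam.hasExactlyComplexStructures_one (map_zero _) 1⟩
    · exact ⟨Realification (⨁ _ : Fin (k + 1), GLam l₀), inferInstance, inferInstance,
        GLam.finiteDimensional_realification l₀ _,
        GLam.isTwoStepNilpotent_realification l₀ (Nat.le_add_left 1 k),
        GLam.hasExactlyComplexStructures_directSum hl₀ (k + 1)⟩
  · exact GLam.nonempty_realification_conj l₀
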